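/- Let $S^3$ be the 3-sphere and let $K\subset S^3$ be a tame knot, given with a tubular neighbourhood, i.e. an open embedding $\varphi\colon\mathbb C\times S^1\to S^3$ with $\varphi(0\times S^1)=K$; the fibres $\mathbb C\times w$ are oriented by the standard orientation of $\mathbb C$, which fixes an orientation of the normal bundle of $K$. Let $N_K=\varphi(\{|v|\le 1\}\times S^1)$ be the regular neighbourhood, $\partial N_K$ its boundary torus, identified with $T^2=S^1\times S^1$ by $\varphi$, and $E_K=S^3-\operatorname{Int}N_K$; fix a basepoint $z\in E_K$. For $p=\varphi(u,w)\in\partial N_K$ let $m_p(t)=\varphi(ue^{2\pi i t},w)$ be the positive meridian loop at $p$. The fundamental quandle $Q(K)$ is the set of homotopy classes of paths in $E_K$ from a point of $\partial N_K$ to $z$, where during a homotopy the initial point may move in $\partial N_K$ and the final point is fixed, with the operations $$[a]\triangleright[b]=[a\cdot\bar b\cdot m_{b(0)}\cdot b],\qquad [a]\triangleleft[b]=[a\cdot\bar b\cdot\overline{m}_{b(0)}\cdot b].$$ A quandle automorphism (resp. antiautomorphism) of $Q(K)$ is a bijection $F\colon Q(K)\to Q(K)$ with $F(x\triangleright y)=F(x)\triangleright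 F(y)$ (resp. $F(x\triangleright y)=F(x)\triangleleft F(y)$) for all $x,y$. Let $f\colon S^3\to S^3$ be a homeomorphism with $f(K)=K$ and $f(N_K)=N_K$ such that the class $[f|_{\partial N_K}]$ in the group $MCG(T^2)$ of isotopy classes of self-homeomorphisms of the torus is $1$ or $-1$, where $-1$ is the class of $(u,w)\mapsto(u^{-1},w^{-1})$. We say that $f$ preserves (resp. reverses) the orientation of the normal bundle of $K$ if it carries positive meridians to loops that are freely homotopic in $N_K-K$ to positive (resp. negative) meridians. Then: 1. $f$ preserves or reverses the orientation of the normal bundle. 2. If $f(z)=z$, then $f_*([a])=[f\circ a]$ is a well-defined bijection $f_*\colon Q(K)\to Q(K)$. It is a quandle automorphism if $f$ preserves the orientation of the normal bundle, and a quandle antiautomorphism if $f$ reverses it. 3. In general there is a path in $E_K$ from $f(z)$ to $z$, and for every such path $\gamma$ the map $f_*([a])=[(f\circ a)\cdot\gamma]$ is a well-defined bijection $Q(K)\to Q(K)$, which is a quandle automorphism if $f$ preserves the orientation of the normal bundle, and a quandle antiautomorphism if $f$ reverses it. -/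

import Mathlib

open Set unitInterval
open scoped Quandles

/-! ### Mapping class groups -/

/-- A self-homeomorphism of `X` is isotopic to the identity if it is the time-one map of a
level-preserving self-homeomorphism of `[0,1] × X` that is the identity at time zero. -/
def IsotopicToId {X : Type*} [TopologicalSpace X] (g : X ≃ₜ X) : Prop :=
  ∃ Φ : (I × X) ≃ₜ (I × X), (∀ q, (Φ q).1 = q.1) ∧
    (∀ x, Φ (0, x) = (0, x)) ∧ (∀ x, Φ (1, x) = (1, g x))

/-- The subgroup `Homeo₀(X)` of self-homeomorphisms isotopic to the identity. -/
def homeoZero (X : Type*) [TopologicalSpace X] : Subgroup (X ≃ₜ X) where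
  carrier := {g | IsotopicToId g}
  one_mem' := ⟨Homeomorph.refl _, fun _ => rfl, fun _ => rfl, fun _ => rfl⟩
  mul_mem' := by
    rintro g h ⟨Φ, h1, h2, h3⟩ ⟨Ψ, k1, k2, k3⟩
    refine ⟨Ψ.trans Φ, fun q => ?_, fun x => ?_, fun x => ?_⟩
    · simp [h1, k1]
    · simp [h2, k2]
    · simp [h3, k3]
  inv_mem' := by
    rintro g ⟨Φ, h1, h2, h3⟩
    refine ⟨Φ.symm, fun q => ?_, fun x => ?_, fun x => ?_⟩
    · rw [← h1 (Φ.symm q), Φ.apply_symm_apply]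
    · rw [Φ.symm_apply_eq, h2]
    · rw [Φ.symm_apply_eq, h3]
      exact congrArg (Prod.mk 1) (g.apply_symm_apply x).symm

instance (X : Type*) [TopologicalSpace X] : (homeoZero X).Normal where
  conj_mem := by
    rintro g ⟨Φ, h1, h2, h3⟩ k
    refine ⟨(((Homeomorph.refl I).prodCongr k).symm.trans Φ).trans
      ((Homeomorph.refl I).prodCongr k), fun q => ?_, fun x => ?_, fun x => ?_⟩
    · simp [h1]
    · simp [h2]
    · simp only [Homeomorph.trans_apply, Homeomorph.prodCongr_symm, Homeomorph.coe_prodCongr,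
        Prod.map_apply, Homeomorph.refl_symm, Homeomorph.refl_apply, id_eq, h3]
      rfl

/-- The (extended) mapping class group: self-homeomorphisms modulo isotopy. -/
abbrev MCG (X : Type*) [TopologicalSpace X] : Type _ := (X ≃ₜ X) ⧸ homeoZero X

/-- The mapping class of a self-homeomorphism. -/
def MCG.mk {X : Type*} [TopologicalSpace X] (g : X ≃ₜ X) : MCG X := QuotientGroup.mk g

/-- The torus `T² = S¹ × S¹`. -/
abbrev Torus : Type := Circle × Circle

/-- The class `-1 ∈ MCG(T²)`, i.e. that of `(u, w) ↦ (u⁻¹, w⁻¹)`, which acts on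
`H₁(T²) = ℤ²` as minus the identity matrix. -/
noncomputable def MCG.negOne : MCG Torus := MCG.mk (Homeomorph.inv Torus)

/-! ### Knots, regular neighbourhoods, exteriors -/

/-- The 3-sphere. -/
abbrev S3 : Type := Metric.sphere (0 : EuclideanSpace ℝ (Fin 4)) 1

/-- A (tame) knot in the 3-sphere together with a trivialised tubular neighbourhood, given by an
open embedding of `ℂ × S¹` that takes `0 × S¹` onto the knot. The fibres `ℂ × w` are the fibres of
the normal bundle, and its orientation is the one carried over from the standard orientation
of `ℂ`. -/
structure Knot where
  /-- The underlying subset `K` of the 3-sphere. -/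
  carrier : Set S3
  /-- The tubular neighbourhood. -/
  tube : ℂ × Circle → S3
  isOpenEmbedding : Topology.IsOpenEmbedding tube
  image_core : tube '' ({0} ×ˢ univ) = carrier

namespace Knot

variable (K : Knot)

/-- The closed regular neighbourhood `N_K`: the unit disc bundle. -/
def nbhd : Set S3 := K.tube '' (Metric.closedBall 0 1 ×ˢ univ)

/-- The boundary torus `∂N_K`. -/
def boundary : Set S3 := frontier K.nbhd

/-- The exterior `E_K = S³ - Int N_K`. -/
def exterior : Set S3 := (interior K.nbhd)ᶜ

lemma boundary_subset_exterior : K.boundary ⊆ K.exterior := fun _ hx => hx.2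

/-- The inclusion of `∂N_K` into `E_K`. -/
def incl : C(K.boundary, K.exterior) :=
  ⟨inclusion K.boundary_subset_exterior, continuous_inclusion _⟩

lemma boundary_eq : K.boundary = K.tube '' (Metric.sphere 0 1 ×ˢ univ) := by
  have hcl : IsClosed K.nbhd :=
    (((isCompact_closedBall (0 : ℂ) 1).prod isCompact_univ).image
      K.isOpenEmbedding.continuous).isClosed
  have hN : K.tube ⁻¹' K.nbhd = Metric.closedBall 0 1 ×ˢ univ :=
    K.isOpenEmbedding.injective.preimage_image _
  have hfr : K.tube ⁻¹' K.boundary = Metric.sphere 0 1 ×ˢ univ := by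
    rw [boundary, K.isOpenEmbedding.isOpenMap.preimage_frontier_eq_frontier_preimage
      K.isOpenEmbedding.continuous, hN, frontier_prod_univ_eq, frontier_closedBall _ one_ne_zero]
  rw [← hfr, image_preimage_eq_of_subset]
  exact (hcl.frontier_subset).trans (image_subset_range _ _)

/-- The parametrisation of `∂N_K` by the torus: the first factor runs along the meridian circles
(the fibres of the normal circle bundle), the second along the knot. -/
noncomputable def torusMap (q : Torus) : K.boundary :=
  ⟨K.tube ((q.1 : ℂ), q.2), by
    rw [K.boundary_eq]
    exact mem_image_of_mem _ ⟨mem_sphere_zero_iff_norm.2 (Circle.norm_coe _), mem_univ _⟩⟩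

lemma torusMap_continuous : Continuous K.torusMap := by
  refine Continuous.subtype_mk (K.isOpenEmbedding.continuous.comp ?_) _
  fun_prop

lemma torusMap_bijective : Function.Bijective K.torusMap := by
  refine ⟨fun q r h => ?_, fun x => ?_⟩
  · have h' := K.isOpenEmbedding.injective (congrArg Subtype.val h)
    simp only [Prod.mk.injEq] at h'
    exact Prod.ext (Circle.ext h'.1) h'.2
  · obtain ⟨⟨u, w⟩, ⟨hu, -⟩, hx⟩ := K.boundary_eq.subset x.2
    exact ⟨(⟨u, by simpa [Submonoid.unitSphere] using hu⟩, w), Subtype.ext hx⟩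

/-- The identification of `∂N_K` with the torus `T²`. -/
noncomputable def torusHomeo : Torus ≃ₜ K.boundary :=
  K.torusMap_continuous.homeoOfEquivCompactToT2
    (f := Equiv.ofBijective K.torusMap K.torusMap_bijective)

/-- The meridian circle through `p ∈ ∂N_K`, positively oriented and starting at `p`. -/
noncomputable def meridianCircle (p : K.boundary) : C(Circle, K.boundary) :=
  ⟨fun v => K.torusHomeo ((K.torusHomeo.symm p).1 * v, (K.torusHomeo.symm p).2), by fun_prop⟩

lemma meridianCircle_one (p : K.boundary) : K.meridianCircle p 1 = p := by
  simp [meridianCircle]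

/-- The meridian loop `m_p` based at `p ∈ ∂N_K`, following the meridian circle through `p` once in
the positive direction. -/
noncomputable def meridian (p : K.boundary) : Path p p where
  toFun t := K.meridianCircle p (Circle.exp (2 * Real.pi * t))
  continuous_toFun := by fun_prop
  source' := by simp [meridianCircle_one]
  target' := by simp [meridianCircle_one]

/-! ### The fundamental quandle -/

/-- A path in `E_K` from a point of `∂N_K` to the basepoint `z`. -/
structure Arc (z : K.exterior) where
  /-- The initial point. -/
  start : K.boundary
  /-- The path. -/
  path : Path (K.incl start) z

variable {K} {z : K.exterior}

/-- Homotopy of arcs: the initial point may move on `∂N_K`, the final point is fixed. -/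
def Arc.Homotopic (a b : K.Arc z) : Prop :=
  ContinuousMap.HomotopicWith a.path.toContinuousMap b.path.toContinuousMap
    fun g => (g 0 : S3) ∈ K.boundary ∧ g 1 = z

lemma Arc.prop (a : K.Arc z) :
    (a.path.toContinuousMap 0 : S3) ∈ K.boundary ∧ a.path.toContinuousMap 1 = z := by
  refine ⟨?_, a.path.target⟩
  have : a.path.toContinuousMap 0 = K.incl a.start := a.path.source
  rw [this]
  exact a.start.2

/-- Homotopy of arcs is an equivalence relation. -/
instance arcSetoid (K : Knot) (z : K.exterior) : Setoid (K.Arc z) where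
  r := Arc.Homotopic
  iseqv :=
    ⟨fun a => ContinuousMap.HomotopicWith.refl _ a.prop, fun h => h.symm, fun h k => h.trans k⟩

/-- The underlying set `Γ_K` of the fundamental quandle `Q(K)`: homotopy classes of paths in `E_K`
from a point of `∂N_K` to the basepoint `z`. -/
def FundQuandle (K : Knot) (z : K.exterior) : Type := Quotient (arcSetoid K z)

/-- The class of an arc in `Q(K)`. -/
def FundQuandle.mk (a : K.Arc z) : FundQuandle K z := Quotient.mk _ a

lemma Arc.homotopic_iff (a b : K.Arc z) : a.Homotopic b ↔
    ∃ n : Path a.start b.start, a.path.Homotopic ((n.map K.incl.continuous).trans b.path) := by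
  constructor
  · rintro ⟨H⟩
    have hH0 : ∀ s, (H (s, 0) : S3) ∈ K.boundary := fun s => (H.prop s).1
    have hH1 : ∀ s, H (s, 1) = z := fun s => (H.prop s).2
    have e0 : H (0, 0) = K.incl a.start := (H.apply_zero 0).trans a.path.source
    have e1 : H (1, 0) = K.incl b.start := (H.apply_one 0).trans b.path.source
    let n : Path a.start b.start :=
      { toFun := fun s => ⟨H (s, 0), hH0 s⟩
        continuous_toFun := by
          refine Continuous.subtype_mk (continuous_subtype_val.comp ?_) _
          exact H.continuous.comp (by fun_prop)
        source' := Subtype.ext (congrArg (fun y : K.exterior => (y : S3)) e0)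
        target' := Subtype.ext (congrArg (fun y : K.exterior => (y : S3)) e1) }
    refine ⟨n, ?_⟩
    have key := (Path.Homotopic.map_trans_evalAt H.toHomotopy (Path.id)).pathCast
      a.path.source.symm b.path.target.symm
    have l1 : (((Path.id).map (map_continuous a.path.toContinuousMap)).trans
        (H.toHomotopy.evalAt 1)).cast a.path.source.symm b.path.target.symm
        = a.path.trans (Path.refl z) := by
      refine Path.ext (funext fun t => ?_)
      simp only [Path.cast_coe, Path.trans_apply]
      split_ifs with ht
      · rfl
      · exact hH1 _
    have l2 : ((H.toHomotopy.evalAt 0).trans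
        ((Path.id).map (map_continuous b.path.toContinuousMap))).cast
          a.path.source.symm b.path.target.symm
        = (n.map K.incl.continuous).trans b.path := by
      ext t
      simp only [Path.cast_coe, Path.trans_apply]
      split_ifs with ht <;> rfl
    rw [l1, l2] at key
    exact (Path.Homotopic.symm ⟨Path.Homotopy.transRefl a.path⟩).trans key
  · rintro ⟨n, ⟨F⟩⟩
    let c : K.Arc z := ⟨a.start, (n.map K.incl.continuous).trans b.path⟩
    have h1 : a.Homotopic c := by
      refine ⟨⟨F.toHomotopy, fun s => ⟨?_, ?_⟩⟩⟩
      · have : F (s, 0) = K.incl a.start := Path.Homotopy.source F s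
        change (F (s, 0) : S3) ∈ _
        rw [this]
        exact a.start.2
      · exact Path.Homotopy.target F s
    have h2 : c.Homotopic b := by
      let r : I × I → I := fun x => ⟨x.1 / 2 + (1 - x.1 / 2) * x.2, by
        have h1 := x.1.2.1
        have h2 := x.1.2.2
        have h3 := x.2.2.1
        have h4 := x.2.2.2
        constructor <;> nlinarith⟩
      have hr : Continuous r := by
        refine Continuous.subtype_mk ?_ _
        fun_prop
      refine ⟨⟨⟨⟨fun x => c.path (r x), c.path.continuous.comp hr⟩, fun t => ?_, fun t => ?_⟩,
        fun s => ⟨?_, ?_⟩⟩⟩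
      · change c.path (r (0, t)) = c.path t
        congr 1
        ext
        simp [r]
      · change c.path (r (1, t)) = b.path t
        simp only [c, Path.trans_apply]
        split_ifs with ht
        · have ht0 : t = 0 := by
            ext
            have h3 := t.2.1
            simp only [r, Icc.coe_one] at ht
            have : (t : ℝ) ≤ 0 := by linarith
            simpa using le_antisymm this h3
          subst ht0
          have : (⟨2 * (r (1, 0) : ℝ), by simp [r]⟩ : I) = 1 := by
            ext
            simp [r]
          rw [Path.source]
          exact (congrArg _ this).trans (Path.target _)
        · congr 1
          ext
          simp only [r, Icc.coe_one]
          ring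
      · change (c.path (r (s, 0)) : S3) ∈ K.boundary
        simp only [c, Path.trans_apply]
        rw [dif_pos (by
          have h2 := s.2.2
          simp only [r, Icc.coe_zero]
          linarith)]
        exact (n _).2
      · change c.path (r (s, 1)) = z
        have : r (s, 1) = 1 := by
          ext
          simp [r]
        rw [this]
        exact c.path.target
    exact h1.trans h2

lemma Arc.homotopic_iff' (a b : K.Arc z) : a.Homotopic b ↔
    ∃ n : Path a.start b.start,
      Path.Homotopic.Quotient.mk a.path = ((Path.Homotopic.Quotient.mk n).map K.incl).trans (Path.Homotopic.Quotient.mk b.path) := by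
  rw [Arc.homotopic_iff]
  refine exists_congr fun n => ?_
  rw [← Path.Homotopic.Quotient.eq, Path.Homotopic.Quotient.mk_trans, Path.Homotopic.Quotient.mk_map]

/-- The right action of `G_K = π₁(E_K, z)` on `Γ_K`, `[a]^[g] = [a · g]`. -/
noncomputable def FundQuandle.act (x : FundQuandle K z) (g : Path.Homotopic.Quotient z z) : FundQuandle K z :=
  Quotient.liftOn₂ x g (fun a g => FundQuandle.mk ⟨a.start, a.path.trans g⟩) (by
    intro a g b h hab hgh
    obtain ⟨n, hn⟩ := (Arc.homotopic_iff' a b).1 hab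
    refine Quotient.sound ((Arc.homotopic_iff' _ _).2 ⟨n, ?_⟩)
    have hgh' : Path.Homotopic.Quotient.mk g = Path.Homotopic.Quotient.mk h :=
      Path.Homotopic.Quotient.eq.2 hgh
    simp only [Path.Homotopic.Quotient.mk_trans, hn, hgh',
      Path.Homotopic.Quotient.trans_assoc])

/-- Transport of meridians along a path in `∂N_K`. -/
lemma meridian_trans {p q : K.boundary} (n : Path p q) :
    ((K.meridian p).trans n).Homotopic (n.trans (K.meridian q)) := by
  let M : (K.meridianCircle p).Homotopy (K.meridianCircle q) :=
    { toFun := fun x => K.meridianCircle (n x.1) x.2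
      continuous_toFun := by
        simp only [meridianCircle, ContinuousMap.coe_mk]
        fun_prop
      map_zero_left := fun v => by simp
      map_one_left := fun v => by simp }
  let e : Path (1 : Circle) 1 :=
    { toFun := fun t => Circle.exp (2 * Real.pi * t)
      continuous_toFun := by fun_prop
      source' := by simp
      target' := by simp }
  have key := (Path.Homotopic.map_trans_evalAt M e).pathCast
    (K.meridianCircle_one p).symm (K.meridianCircle_one q).symm
  have hM : ∀ t, M.evalAt 1 t = n t := fun t => K.meridianCircle_one (n t)
  have l1 : ((e.map (map_continuous (K.meridianCircle p))).trans (M.evalAt 1)).cast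
      (K.meridianCircle_one p).symm (K.meridianCircle_one q).symm
      = (K.meridian p).trans n := by
    ext t
    simp only [Path.cast_coe, Path.trans_apply]
    split_ifs with ht
    · rfl
    · rw [hM]
  have l2 : ((M.evalAt 1).trans (e.map (map_continuous (K.meridianCircle q)))).cast
      (K.meridianCircle_one p).symm (K.meridianCircle_one q).symm
      = n.trans (K.meridian q) := by
    ext t
    simp only [Path.cast_coe, Path.trans_apply]
    split_ifs with ht
    · rw [hM]
    · rfl
  rwa [l1, l2] at key

/-- The loop `b̄ · m_{b(0)} · b` at the basepoint. -/
noncomputable def Arc.loop (b : K.Arc z) : Path z z :=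
  b.path.symm.trans (((K.meridian b.start).map K.incl.continuous).trans b.path)

lemma Arc.loop_eq {a b : K.Arc z} (h : a.Homotopic b) :
    Path.Homotopic.Quotient.mk a.loop = Path.Homotopic.Quotient.mk b.loop := by
  obtain ⟨n, hn⟩ := (Arc.homotopic_iff' a b).1 h
  have hm : ((Path.Homotopic.Quotient.mk (K.meridian a.start)).map K.incl).trans ((Path.Homotopic.Quotient.mk n).map K.incl) =
      ((Path.Homotopic.Quotient.mk n).map K.incl).trans ((Path.Homotopic.Quotient.mk (K.meridian b.start)).map K.incl) := by
    have := Path.Homotopic.Quotient.eq.2 ((meridian_trans n).map K.incl)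
    rw [Path.map_trans, Path.map_trans] at this
    exact this
  have hs : (Path.Homotopic.Quotient.mk a.path).symm =
      (Path.Homotopic.Quotient.mk b.path).symm.trans ((Path.Homotopic.Quotient.mk n).map K.incl).symm := by
    have := congrArg Path.Homotopic.Quotient.symm hn
    rw [this, ← Path.Homotopic.Quotient.mk_map, ← Path.Homotopic.Quotient.mk_trans, ← Path.Homotopic.Quotient.mk_symm, Path.trans_symm]
    rfl
  simp only [Arc.loop, Path.Homotopic.Quotient.mk_trans, Path.Homotopic.Quotient.mk_symm, Path.Homotopic.Quotient.mk_map]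
  rw [hs, hn, Path.Homotopic.Quotient.trans_assoc, ← Path.Homotopic.Quotient.trans_assoc (Path.Homotopic.Quotient.map _ _) (Path.Homotopic.Quotient.map _ _),
    hm, Path.Homotopic.Quotient.trans_assoc, ← Path.Homotopic.Quotient.trans_assoc (Path.Homotopic.Quotient.symm (Path.Homotopic.Quotient.map _ _)),
    Path.Homotopic.Quotient.symm_trans, Path.Homotopic.Quotient.refl_trans]

/-- The augmentation `∂ : Γ_K → G_K`, `∂[b] = [b̄ · m_{b(0)} · b]`. -/
noncomputable def FundQuandle.bd (x : FundQuandle K z) : Path.Homotopic.Quotient z z :=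
  Quotient.liftOn x (fun b => Path.Homotopic.Quotient.mk b.loop) fun _ _ h => Arc.loop_eq h

namespace FundQuandle

lemma ind {P : FundQuandle K z → Prop} (h : ∀ a, P (mk a)) (x : FundQuandle K z) : P x :=
  _root_.Quotient.ind h x

lemma act_mk (a : K.Arc z) (g : Path z z) :
    act (mk a) (Path.Homotopic.Quotient.mk g) = mk ⟨a.start, a.path.trans g⟩ := rfl

lemma bd_mk (b : K.Arc z) : bd (mk b) = Path.Homotopic.Quotient.mk b.loop := rfl

lemma mk_eq_iff (a b : K.Arc z) : mk a = mk b ↔ a.Homotopic b := _root_.Quotient.eq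

lemma mk_eq_of_path {p : K.boundary} {a b : Path (K.incl p) z}
    (h : Path.Homotopic.Quotient.mk a = Path.Homotopic.Quotient.mk b) :
    (mk ⟨p, a⟩ : FundQuandle K z) = mk ⟨p, b⟩ := by
  rw [mk_eq_iff, Arc.homotopic_iff']
  refine ⟨Path.refl p, ?_⟩
  rw [← Path.Homotopic.Quotient.mk_map]
  change Path.Homotopic.Quotient.mk a = (Path.Homotopic.Quotient.refl _).trans (Path.Homotopic.Quotient.mk b)
  rw [h, Path.Homotopic.Quotient.refl_trans]

lemma act_trans (x : FundQuandle K z) (g h : Path.Homotopic.Quotient z z) :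
    act x (g.trans h) = act (act x g) h := by
  induction x using ind with | h a =>
  induction g with | mk g =>
  induction h with | mk h =>
  rw [← Path.Homotopic.Quotient.mk_trans, act_mk, act_mk, act_mk]
  apply mk_eq_of_path
  simp only [Path.Homotopic.Quotient.mk_trans, Path.Homotopic.Quotient.trans_assoc]

lemma act_refl (x : FundQuandle K z) : act x (Path.Homotopic.Quotient.refl z) = x := by
  induction x using ind with | h a =>
  rw [← Path.Homotopic.Quotient.mk_refl, act_mk]
  apply mk_eq_of_path
  simp only [Path.Homotopic.Quotient.mk_trans, Path.Homotopic.Quotient.mk_refl, Path.Homotopic.Quotient.trans_refl]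

/-- First augmentation condition: `x^{∂x} = x`. -/
lemma act_bd_self (x : FundQuandle K z) : act x (bd x) = x := by
  induction x using ind with | h a =>
  rw [bd_mk, act_mk, mk_eq_iff, Arc.homotopic_iff']
  refine ⟨K.meridian a.start, ?_⟩
  simp only [Arc.loop, Path.Homotopic.Quotient.mk_trans, Path.Homotopic.Quotient.mk_symm, Path.Homotopic.Quotient.mk_map]
  rw [← Path.Homotopic.Quotient.trans_assoc, Path.Homotopic.Quotient.trans_symm, Path.Homotopic.Quotient.refl_trans]

/-- Second augmentation condition: `∂(x^g) = g⁻¹ (∂x) g`. -/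
lemma bd_act (x : FundQuandle K z) (g : Path.Homotopic.Quotient z z) :
    bd (act x g) = g.symm.trans ((bd x).trans g) := by
  induction x using ind with | h a =>
  induction g with | mk g =>
  rw [act_mk, bd_mk, bd_mk]
  simp only [Arc.loop, Path.trans_symm, Path.Homotopic.Quotient.mk_trans, Path.Homotopic.Quotient.mk_symm,
    Path.Homotopic.Quotient.trans_assoc]

/-- The fundamental quandle. In the notation of right actions, `y ◃ x` is `x ▷ y = x^{∂y}` and
`y ◃⁻¹ x` is `x ◁ y = x^{(∂y)⁻¹}`. -/
noncomputable instance : Quandle (FundQuandle K z) where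
  act y x := act x (bd y)
  invAct y x := act x (bd y).symm
  self_distrib := by
    intro x y w
    rw [bd_act, ← act_trans, ← act_trans, ← Path.Homotopic.Quotient.trans_assoc, Path.Homotopic.Quotient.trans_symm,
      Path.Homotopic.Quotient.refl_trans]
  left_inv := fun y x => by
    beta_reduce
    rw [← act_trans, Path.Homotopic.Quotient.trans_symm, act_refl]
  right_inv := fun y x => by
    beta_reduce
    rw [← act_trans, Path.Homotopic.Quotient.symm_trans, act_refl]
  fix := act_bd_self _

/-- `x ▷ y = x^{∂y}`; on representatives, `[a] ▷ [b] = [a · b̄ · m_{b(0)} · b]`. -/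
noncomputable def tr (x y : FundQuandle K z) : FundQuandle K z := y ◃ x

/-- `x ◁ y = x^{(∂y)⁻¹}`. -/
noncomputable def tl (x y : FundQuandle K z) : FundQuandle K z := y ◃⁻¹ x

/-- A quandle automorphism of `Q(K)`. -/
def IsAut (F : FundQuandle K z → FundQuandle K z) : Prop :=
  Function.Bijective F ∧ ∀ x y, F (tr x y) = tr (F x) (F y)

/-- A quandle antiautomorphism of `Q(K)`. -/
def IsAntiAut (F : FundQuandle K z → FundQuandle K z) : Prop :=
  Function.Bijective F ∧ ∀ x y, F (tr x y) = tl (F x) (F y)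

end FundQuandle

/-! ### Homeomorphisms preserving the regular neighbourhood -/

variable (K)

/-- The restriction of a homeomorphism with `f(N_K) = N_K` to the boundary torus. -/
def boundaryHomeo (f : S3 ≃ₜ S3) (hN : f '' K.nbhd = K.nbhd) : K.boundary ≃ₜ K.boundary :=
  f.subtype fun x => by
    have h : f '' K.boundary = K.boundary := by rw [boundary, f.image_frontier, hN]
    refine ⟨fun hx => h ▸ mem_image_of_mem f hx, fun hx => ?_⟩
    change f x ∈ K.boundary at hx
    rw [← h] at hx
    exact f.injective.mem_set_image.1 hx

/-- The restriction of a homeomorphism with `f(N_K) = N_K` to the exterior. -/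
def exteriorHomeo (f : S3 ≃ₜ S3) (hN : f '' K.nbhd = K.nbhd) : K.exterior ≃ₜ K.exterior :=
  f.subtype fun x => by
    have h : f '' interior K.nbhd = interior K.nbhd := by rw [f.image_interior, hN]
    change x ∉ interior K.nbhd ↔ f x ∉ interior K.nbhd
    rw [← f.injective.mem_set_image (s := interior K.nbhd), h]

/-- The mapping class `[f|_{∂N_K}] ∈ MCG(T²)`. -/
noncomputable def boundaryClass (f : S3 ≃ₜ S3) (hN : f '' K.nbhd = K.nbhd) : MCG Torus :=
  MCG.mk ((K.torusHomeo.trans (K.boundaryHomeo f hN)).trans K.torusHomeo.symm)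

/-- The positively oriented meridian circle through `p`, as a map into the 3-sphere. -/
noncomputable def posMeridian (p : K.boundary) : C(Circle, S3) :=
  ⟨fun v => K.meridianCircle p v,
    continuous_subtype_val.comp (K.meridianCircle p).continuous⟩

/-- The negatively oriented meridian circle through `p`, as a map into the 3-sphere. -/
noncomputable def negMeridian (p : K.boundary) : C(Circle, S3) :=
  ⟨fun v => K.meridianCircle p v⁻¹,
    continuous_subtype_val.comp ((K.meridianCircle p).continuous.comp continuous_inv)⟩

/-- Free homotopy of loops in the punctured neighbourhood `N_K - K`. -/
def FreelyHomotopic (c d : C(Circle, S3)) : Prop :=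
  ContinuousMap.HomotopicWith c d fun g => ∀ v, g v ∈ K.nbhd \ K.carrier

/-- `f` preserves the orientation of the normal bundle: it carries positively oriented meridians to
loops around `K` that are freely homotopic in `N_K - K` to positively oriented meridians. -/
def PreservesNormalOrientation (f : S3 ≃ₜ S3) : Prop :=
  ∀ p q : K.boundary, K.FreelyHomotopic ((f : C(S3, S3)).comp (K.posMeridian p)) (K.posMeridian q)

/-- `f` reverses the orientation of the normal bundle. -/
def ReversesNormalOrientation (f : S3 ≃ₜ S3) : Prop :=
  ∀ p q : K.boundary, K.FreelyHomotopic ((f : C(S3, S3)).comp (K.posMeridian p)) (K.negMeridian q)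

variable {K} {z : K.exterior}

/-- The image `f ∘ a` of an arc, extended by a path `γ` in `E_K` from `f(z)` back to the
basepoint `z`. -/
noncomputable def Arc.image (f : S3 ≃ₜ S3) (hN : f '' K.nbhd = K.nbhd) (γ : Path (K.exteriorHomeo f hN z) z)
    (a : K.Arc z) : K.Arc z :=
  ⟨K.boundaryHomeo f hN a.start, (a.path.map (K.exteriorHomeo f hN).continuous).trans γ⟩

/-- The image `f ∘ a` of an arc, if `f` fixes the basepoint. -/
def Arc.image₀ (f : S3 ≃ₜ S3) (hN : f '' K.nbhd = K.nbhd) (hz : K.exteriorHomeo f hN z = z)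
    (a : K.Arc z) : K.Arc z :=
  ⟨K.boundaryHomeo f hN a.start,
    (a.path.map (K.exteriorHomeo f hN).continuous).cast rfl hz.symm⟩

end Knot

/-!
The retraction `(v, w) ↦ (v / |v|, w)` of `N_K - K` onto `∂N_K` pushes the free homotopy between
`f ∘ m_p` and `m_q` or its inverse into the torus `∂N_K`. There meridians commute with all paths, so
the conjugation by the trace of the base point disappears: `[f ∘ m_p] = [m_{f(p)}]^{±1}` holds
between based loops. Since `x ▷ y = x^{∂y}` and `f_*` is equivariant along the endomorphism
`[g] ↦ [γ̄ · (f ∘ g) · γ]` of the knot group, which then takes `∂y` to `(∂ f_*(y))^{±1}`, the map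
`f_*` respects the operations, up to exchanging them when the sign is negative.
-/

/-! ### Homotopy classes of paths -/

section PathClasses

open Path.Homotopic.Quotient

variable {X Y : Type*} [TopologicalSpace X] [TopologicalSpace Y] {x y w : X}

lemma pathClass_trans_symm_cancel_left (p : Path.Homotopic.Quotient x y)
    (q : Path.Homotopic.Quotient x w) : p.trans (p.symm.trans q) = q := by
  rw [← trans_assoc, trans_symm, refl_trans]

lemma pathClass_symm_trans_cancel_left (p : Path.Homotopic.Quotient x y)
    (q : Path.Homotopic.Quotient y w) : p.symm.trans (p.trans q) = q := by
  rw [← trans_assoc, symm_trans, refl_trans]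

lemma pathClass_symm_trans_cancel_right (p : Path.Homotopic.Quotient x y)
    (q : Path.Homotopic.Quotient w y) : (p.trans q.symm).trans q = p := by
  rw [trans_assoc, symm_trans, trans_refl]

lemma pathClass_trans_left_inj {p q : Path.Homotopic.Quotient x y}
    {r : Path.Homotopic.Quotient y w} : p.trans r = q.trans r ↔ p = q :=
  ⟨fun h => by
    simpa only [trans_assoc, trans_symm, trans_refl] using congrArg (fun s => s.trans r.symm) h,
    fun h => h ▸ rfl⟩

lemma pathClass_symm_symm (p : Path.Homotopic.Quotient x y) : p.symm.symm = p := by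
  induction p with | mk p => simp only [← mk_symm, Path.symm_symm]

lemma pathClass_trans_symm (p : Path.Homotopic.Quotient x y) (q : Path.Homotopic.Quotient y w) :
    (p.trans q).symm = q.symm.trans p.symm := by
  induction p with | mk p =>
  induction q with | mk q =>
  simp only [← mk_trans, ← mk_symm, Path.trans_symm]

lemma pathClass_map_trans (p : Path.Homotopic.Quotient x y) (q : Path.Homotopic.Quotient y w)
    (f : C(X, Y)) : (p.trans q).map f = (p.map f).trans (q.map f) := by
  induction p with | mk p =>
  induction q with | mk q =>
  simp only [← mk_trans, ← mk_map, Path.map_trans]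

lemma pathClass_map_symm (p : Path.Homotopic.Quotient x y) (f : C(X, Y)) :
    p.symm.map f = (p.map f).symm := by
  induction p with | mk p => simp only [← mk_symm, ← mk_map, Path.map_symm]

lemma pathClass_symm_trans_comm {p q : Path.Homotopic.Quotient x x}
    (h : p.trans q = q.trans p) : p.symm.trans q = q.trans p.symm := by
  refine (pathClass_trans_left_inj (r := p)).1 ?_
  rw [trans_assoc, ← h, pathClass_symm_trans_cancel_left, trans_assoc, symm_trans, trans_refl]

lemma pathClass_conj_symm (p : Path.Homotopic.Quotient x y) (m : Path.Homotopic.Quotient x x) :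
    (p.symm.trans (m.trans p)).symm = p.symm.trans (m.symm.trans p) := by
  rw [pathClass_trans_symm, pathClass_trans_symm, pathClass_symm_symm, trans_assoc]

lemma pathClass_conj_map (f : C(X, Y)) {v : Y} (p : Path.Homotopic.Quotient x y)
    (m : Path.Homotopic.Quotient x x) (r : Path.Homotopic.Quotient (f y) v) :
    r.symm.trans (((p.symm.trans (m.trans p)).map f).trans r) =
      ((p.map f).trans r).symm.trans ((m.map f).trans ((p.map f).trans r)) := by
  simp only [pathClass_trans_symm, pathClass_map_trans, pathClass_map_symm, trans_assoc]

lemma pathClass_map_homeomorph_bijective (e : X ≃ₜ Y) (x y : X) :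
    Function.Bijective fun p : Path.Homotopic.Quotient x y => p.map (e : C(X, Y)) :=
  (FundamentalGroupoidFunctor.equivOfHomotopyEquiv
    e.toHomotopyEquiv).fullyFaithfulFunctor.map_bijective ⟨x⟩ ⟨y⟩

lemma pathClass_map_trans_eq_iff (e : X ≃ₜ Y) {v : Y} {p : Path.Homotopic.Quotient x w}
    {n : Path.Homotopic.Quotient x y} {q : Path.Homotopic.Quotient y w}
    {r : Path.Homotopic.Quotient (e w) v} :
    (p.map (e : C(X, Y))).trans r =
      (n.map (e : C(X, Y))).trans ((q.map (e : C(X, Y))).trans r) ↔ p = n.trans q := by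
  rw [← trans_assoc, pathClass_trans_left_inj, ← pathClass_map_trans]
  exact (pathClass_map_homeomorph_bijective e x w).injective.eq_iff

end PathClasses

/-- The loop running once around the circle in the positive direction, so that loops on a space
can be compared with maps out of the circle. -/
noncomputable def circleLoop : Path (1 : Circle) 1 where
  toFun t := Circle.exp (2 * Real.pi * t)
  continuous_toFun := by fun_prop
  source' := by simp
  target' := by simp

lemma exists_conj_of_circle_homotopic {X : Type*} [TopologicalSpace X] {c d : C(Circle, X)}
    (h : c.Homotopic d) {x y : X} {γ : Path x x} {δ : Path y y}
    (hγ : ∀ t, γ t = c (circleLoop t)) (hδ : ∀ t, δ t = d (circleLoop t)) :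
    ∃ n : Path x y, (Path.Homotopic.Quotient.mk γ).trans (.mk n) =
      (Path.Homotopic.Quotient.mk n).trans (.mk δ) := by
  obtain rfl : x = c 1 := by simpa using hγ 0
  obtain rfl : y = d 1 := by simpa using hδ 0
  obtain rfl : γ = circleLoop.map c.continuous := Path.ext (funext hγ)
  obtain rfl : δ = circleLoop.map d.continuous := Path.ext (funext hδ)
  obtain ⟨H⟩ := h
  exact ⟨H.evalAt 1, Path.Homotopic.Quotient.eq.2 (Path.Homotopic.map_trans_evalAt H circleLoop)⟩

lemma exists_frontier_joinedIn_compl_interior {X : Type*} [TopologicalSpace X] {s : Set X}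
    {x y : X} (h : Joined x y) (hx : x ∉ interior s) (hy : y ∈ frontier s) :
    ∃ b ∈ frontier s, JoinedIn (interior s)ᶜ x b := by
  obtain ⟨γ⟩ := h
  -- Cut the path where it first meets the frontier: before that it cannot enter the interior.
  obtain ⟨t₀, ht₀, hmin⟩ := (isClosed_frontier.preimage γ.continuous).isCompact.exists_isLeast
    ⟨1, by simpa using hy⟩
  have hout : γ '' Icc 0 t₀ ⊆ (interior s)ᶜ := by
    rintro _ ⟨t, ht, rfl⟩ hts
    have hlt : t < t₀ := ht.2.lt_of_ne fun h => ht₀.2 (h ▸ hts)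
    have hin : γ '' Icc 0 t ⊆ interior s :=
      (isPreconnected_Icc.image γ γ.continuous.continuousOn).subset_of_closure_inter_subset
        isOpen_interior ⟨γ t, mem_image_of_mem γ (right_mem_Icc.2 ht.1), hts⟩ <| by
          rintro _ ⟨hr, r, hrt, rfl⟩
          by_contra hri
          exact (hrt.2.trans_lt hlt).not_ge (hmin ⟨closure_mono interior_subset hr, hri⟩)
    exact hx (hin ⟨0, left_mem_Icc.2 ht.1, γ.source⟩)
  have hsub (t) : γ.subpath 0 t₀ t ∈ (interior s)ᶜ :=
    hout ((γ.range_subpath_of_le 0 t₀ t₀.2.1).subset (mem_range_self t))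
  exact ⟨γ t₀, ht₀, (γ.subpath 0 t₀).cast γ.source.symm rfl, hsub⟩

instance : PathConnectedSpace S3 :=
  isPathConnected_iff_pathConnectedSpace.1 (isPathConnected_sphere (by
    rw [rank_eq_card_basis (EuclideanSpace.basisFun (Fin 4) ℝ).toBasis]
    simp) 0 zero_le_one)

lemma IsotopicToId.homotopic {X : Type*} [TopologicalSpace X] {g : X ≃ₜ X}
    (h : IsotopicToId g) : (ContinuousMap.id X).Homotopic (g : C(X, X)) := by
  obtain ⟨Φ, -, h0, h1⟩ := h
  exact ⟨{
    toFun := fun x => (Φ x).2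
    continuous_toFun := by fun_prop
    map_zero_left := fun x => by simp [h0]
    map_one_left := fun x => by simp [h1] }⟩

lemma MCG.homotopic_of_mk_eq {X : Type*} [TopologicalSpace X] {g h : X ≃ₜ X}
    (hgh : MCG.mk g = MCG.mk h) : (g : C(X, X)).Homotopic (h : C(X, X)) := by
  have hiso : IsotopicToId (g⁻¹ * h) := QuotientGroup.eq.1 hgh
  have hcomp : (g : C(X, X)).comp ((g⁻¹ * h : X ≃ₜ X) : C(X, X)) = h :=
    ContinuousMap.ext fun x => g.apply_symm_apply (h x)
  exact hcomp ▸ (ContinuousMap.Homotopic.refl (g : C(X, X))).comp hiso.homotopic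

namespace Knot

variable {K : Knot} {z : K.exterior}

lemma boundary_joined (p q : K.boundary) : Joined p q := by
  obtain ⟨x, rfl⟩ := K.torusHomeo.surjective p
  obtain ⟨y, rfl⟩ := K.torusHomeo.surjective q
  exact (PathConnectedSpace.joined x y).map K.torusHomeo.continuous

lemma exterior_joined (x y : K.exterior) : Joined x y := by
  let p := K.torusHomeo 1
  have hp (x : K.exterior) : Joined x (K.incl p) := by
    obtain ⟨b, hb, hxb⟩ := exists_frontier_joinedIn_compl_interior
      (PathConnectedSpace.joined (x : S3) p) x.2 p.2
    exact (joinedIn_iff_joined _ _).1 hxb |>.trans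
      ((boundary_joined ⟨b, hb⟩ p).map K.incl.continuous)
  exact (hp x).trans (hp y).symm

/-! ### Meridians and the orientation of the normal bundle -/

lemma meridianCircle_homotopic (p q : K.boundary) :
    (K.meridianCircle p).Homotopic (K.meridianCircle q) := by
  obtain ⟨n⟩ := boundary_joined p q
  exact ⟨{
    toFun := fun x => K.meridianCircle (n x.1) x.2
    continuous_toFun := by
      simp only [meridianCircle, ContinuousMap.coe_mk]
      fun_prop
    map_zero_left := fun v => by simp
    map_one_left := fun v => by simp }⟩

lemma boundary_subset_nbhd_diff_carrier : K.boundary ⊆ K.nbhd \ K.carrier := by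
  rw [boundary_eq]
  rintro _ ⟨⟨v, w⟩, ⟨hv, -⟩, rfl⟩
  refine ⟨mem_image_of_mem _ ⟨Metric.sphere_subset_closedBall hv, mem_univ _⟩, ?_⟩
  rw [← K.image_core, K.isOpenEmbedding.injective.mem_set_image]
  rintro ⟨rfl, -⟩
  simp at hv

lemma exists_retraction_onto_boundary : ∃ r : C(↥(K.nbhd \ K.carrier), K.boundary),
    ∀ p : K.boundary, r ⟨p, boundary_subset_nbhd_diff_carrier p.2⟩ = p := by
  let e := K.isOpenEmbedding.toIsEmbedding.toHomeomorph
  let c (x : ↥(K.nbhd \ K.carrier)) : ℂ × Circle :=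
    e.symm ⟨x, image_subset_range _ _ x.2.1⟩
  have hc : Continuous c :=
    e.symm.continuous.comp (continuous_subtype_val.subtype_mk _)
  have htube (x) : K.tube (c x) = x := congrArg Subtype.val (e.apply_symm_apply _)
  have hne (x) : (c x).1 ≠ 0 := fun h =>
    x.2.2 (K.image_core.subset ⟨c x, ⟨h, mem_univ _⟩, htube x⟩)
  have hsphere (p : K.boundary) : ‖(c ⟨p, boundary_subset_nbhd_diff_carrier p.2⟩).1‖ = 1 := by
    have hp := K.boundary_eq.subset p.2
    rw [← htube ⟨p, boundary_subset_nbhd_diff_carrier p.2⟩,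
      K.isOpenEmbedding.injective.mem_set_image] at hp
    simpa only [mem_prod, mem_sphere_zero_iff_norm, mem_univ, and_true] using hp
  refine ⟨⟨fun x => ⟨K.tube ((c x).1 / ‖(c x).1‖, (c x).2), ?_⟩, ?_⟩, fun p => Subtype.ext ?_⟩
  · rw [K.boundary_eq]
    exact mem_image_of_mem _ ⟨by simp [hne], mem_univ _⟩
  · refine (K.isOpenEmbedding.continuous.comp (.prodMk ?_ hc.snd)).subtype_mk _
    exact hc.fst.div (by fun_prop) fun x => by simpa using hne x
  · simpa [hsphere] using htube _

lemma freelyHomotopic_iff_homotopic (c d : C(Circle, K.boundary)) :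
    K.FreelyHomotopic (ContinuousMap.comp ⟨Subtype.val, continuous_subtype_val⟩ c)
      (ContinuousMap.comp ⟨Subtype.val, continuous_subtype_val⟩ d) ↔ c.Homotopic d := by
  constructor
  · rintro ⟨H⟩
    obtain ⟨r, hr⟩ := exists_retraction_onto_boundary (K := K)
    have hH (x) : H x ∈ K.nbhd \ K.carrier := H.prop x.1 x.2
    exact ⟨{
      toFun := fun x => r ⟨H x, hH x⟩
      continuous_toFun := by fun_prop
      map_zero_left := fun v => by simp [hr]
      map_one_left := fun v => by simp [hr] }⟩
  · rintro ⟨H⟩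
    exact ⟨{
      toFun := fun x => H x
      continuous_toFun := by fun_prop
      map_zero_left := fun v => by simp
      map_one_left := fun v => by simp
      prop' := fun t v => boundary_subset_nbhd_diff_carrier (H (t, v)).2 }⟩

variable {f : S3 ≃ₜ S3} (hN : f '' K.nbhd = K.nbhd)

lemma preservesNormalOrientation_iff : K.PreservesNormalOrientation f ↔ ∀ p q : K.boundary,
    ((K.boundaryHomeo f hN : C(K.boundary, K.boundary)).comp (K.meridianCircle p)).Homotopic
      (K.meridianCircle q) :=
  forall₂_congr fun p q => freelyHomotopic_iff_homotopic
    ((K.boundaryHomeo f hN : C(K.boundary, K.boundary)).comp (K.meridianCircle p))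
    (K.meridianCircle q)

lemma reversesNormalOrientation_iff : K.ReversesNormalOrientation f ↔ ∀ p q : K.boundary,
    ((K.boundaryHomeo f hN : C(K.boundary, K.boundary)).comp (K.meridianCircle p)).Homotopic
      ((K.meridianCircle q).comp (Homeomorph.inv Circle : C(Circle, Circle))) :=
  forall₂_congr fun p q => freelyHomotopic_iff_homotopic
    ((K.boundaryHomeo f hN : C(K.boundary, K.boundary)).comp (K.meridianCircle p))
    ((K.meridianCircle q).comp (Homeomorph.inv Circle : C(Circle, Circle)))

lemma boundaryHomeo_homotopic {g : Torus ≃ₜ Torus} (h : K.boundaryClass f hN = MCG.mk g) :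
    (K.boundaryHomeo f hN : C(K.boundary, K.boundary)).Homotopic
      ((K.torusHomeo.symm.trans g).trans K.torusHomeo : K.boundary ≃ₜ K.boundary) := by
  have hconj := (ContinuousMap.Homotopic.refl (K.torusHomeo : C(Torus, K.boundary))).comp
    ((MCG.homotopic_of_mk_eq h).comp (.refl (K.torusHomeo.symm : C(K.boundary, Torus))))
  convert hconj using 1
  · exact ContinuousMap.ext fun p => by simp
  · rfl

lemma preservesNormalOrientation_of_boundaryClass_eq_one (h : K.boundaryClass f hN = 1) :
    K.PreservesNormalOrientation f := by
  refine (preservesNormalOrientation_iff hN).2 fun p q =>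
    ((boundaryHomeo_homotopic (g := 1) hN h).comp (.refl _)).trans ?_
  convert meridianCircle_homotopic p q using 1
  exact ContinuousMap.ext fun v => K.torusHomeo.apply_symm_apply _

lemma reversesNormalOrientation_of_boundaryClass_eq_negOne
    (h : K.boundaryClass f hN = MCG.negOne) : K.ReversesNormalOrientation f := by
  refine (reversesNormalOrientation_iff hN).2 fun p q =>
    ((boundaryHomeo_homotopic hN h).comp (.refl _)).trans ?_
  convert (meridianCircle_homotopic (K.torusHomeo (K.torusHomeo.symm p)⁻¹) q).comp
    (.refl (Homeomorph.inv Circle : C(Circle, Circle))) using 1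
  exact ContinuousMap.ext fun v => by simp [meridianCircle, mul_comm]

lemma meridian_symm_apply (p : K.boundary) (t : I) :
    (K.meridian p).symm t = K.meridianCircle p (circleLoop t)⁻¹ := by
  change K.meridianCircle p (Circle.exp (2 * Real.pi * (σ t : I))) =
    K.meridianCircle p (Circle.exp (2 * Real.pi * t))⁻¹
  simp [mul_sub, Circle.exp_sub]

lemma mk_meridian_trans {p q : K.boundary} (n : Path.Homotopic.Quotient p q) :
    (Path.Homotopic.Quotient.mk (K.meridian p)).trans n = n.trans (.mk (K.meridian q)) := by
  induction n with | mk n => exact Path.Homotopic.Quotient.eq.2 (meridian_trans n)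

lemma map_mk_meridian_of_preservesNormalOrientation (h : K.PreservesNormalOrientation f)
    (p : K.boundary) : (Path.Homotopic.Quotient.mk (K.meridian p)).map
      (K.boundaryHomeo f hN : C(K.boundary, K.boundary)) =
      .mk (K.meridian (K.boundaryHomeo f hN p)) := by
  obtain ⟨n, hn⟩ := exists_conj_of_circle_homotopic
    (γ := (K.meridian p).map (K.boundaryHomeo f hN).continuous)
    (preservesNormalOrientation_iff hN |>.1 h p (K.boundaryHomeo f hN p)) (δ := K.meridian _)
    (fun _ => rfl) fun _ => rfl
  exact pathClass_trans_left_inj.1 (hn.trans (mk_meridian_trans _).symm)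

lemma map_mk_meridian_of_reversesNormalOrientation (h : K.ReversesNormalOrientation f)
    (p : K.boundary) : (Path.Homotopic.Quotient.mk (K.meridian p)).map
      (K.boundaryHomeo f hN : C(K.boundary, K.boundary)) =
      (Path.Homotopic.Quotient.mk (K.meridian (K.boundaryHomeo f hN p))).symm := by
  obtain ⟨n, hn⟩ := exists_conj_of_circle_homotopic
    (γ := (K.meridian p).map (K.boundaryHomeo f hN).continuous)
    (reversesNormalOrientation_iff hN |>.1 h p (K.boundaryHomeo f hN p)) (fun _ => rfl)
    (meridian_symm_apply _)
  exact pathClass_trans_left_inj.1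
    (hn.trans (pathClass_symm_trans_comm (mk_meridian_trans _)).symm)

/-! ### The induced map on the fundamental quandle -/

lemma Arc.homotopic_iff_exists_pathClass {a b : K.Arc z} : a.Homotopic b ↔
    ∃ n : Path.Homotopic.Quotient a.start b.start,
      Path.Homotopic.Quotient.mk a.path = (n.map K.incl).trans (.mk b.path) :=
  (Arc.homotopic_iff' a b).trans (Path.Homotopic.Quotient.mk_surjective.exists
    (p := fun n => Path.Homotopic.Quotient.mk a.path = (n.map K.incl).trans (.mk b.path))).symm

namespace FundQuandle

variable (γ : Path (K.exteriorHomeo f hN z) z)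

lemma image_homotopic_iff (a b : K.Arc z) :
    (a.image f hN γ).Homotopic (b.image f hN γ) ↔ a.Homotopic b := by
  have hbd := pathClass_map_homeomorph_bijective (K.boundaryHomeo f hN) a.start b.start
  rw [Arc.homotopic_iff_exists_pathClass, Arc.homotopic_iff_exists_pathClass]
  refine hbd.surjective.exists.trans (exists_congr fun n => ?_)
  induction n with | mk n =>
  exact pathClass_map_trans_eq_iff (K.exteriorHomeo f hN) (p := .mk a.path)
    (n := .map (.mk n) K.incl) (q := .mk b.path) (r := .mk γ)

/-- The map `f_*[a] = [(f ∘ a) · γ]` of the fundamental quandle induced by `f`. -/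
noncomputable def map : FundQuandle K z → FundQuandle K z :=
  _root_.Quotient.map (Arc.image f hN γ) fun a b => (image_homotopic_iff hN γ a b).2

lemma map_mk (a : K.Arc z) : map hN γ (mk a) = mk (a.image f hN γ) := rfl

lemma map_bijective : Function.Bijective (map hN γ) := by
  refine ⟨fun x y h => ?_, fun y => ?_⟩
  · induction x using ind with | h a =>
    induction y using ind with | h b =>
    rw [map_mk, map_mk, mk_eq_iff, image_homotopic_iff] at h
    exact (mk_eq_iff a b).2 h
  · induction y using ind with | h b =>
    obtain ⟨q, b⟩ := b
    obtain ⟨p, rfl⟩ := (K.boundaryHomeo f hN).surjective q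
    obtain ⟨c, hc⟩ := (pathClass_map_homeomorph_bijective (K.exteriorHomeo f hN)
      (K.incl p) z).surjective ((Path.Homotopic.Quotient.mk b).trans (.symm (.mk γ)))
    induction c with | mk c =>
    refine ⟨mk ⟨p, c⟩, mk_eq_of_path (p := K.boundaryHomeo f hN p) ?_⟩
    exact (congrArg (fun s => s.trans (.mk γ)) hc).trans
      (pathClass_symm_trans_cancel_right (.mk b) (.mk γ))

/-- The endomorphism `[g] ↦ [γ̄ · (f ∘ g) · γ]` of the knot group, along which `map` is equivariant
for the action on the fundamental quandle. -/
noncomputable def loopMap (g : Path.Homotopic.Quotient z z) : Path.Homotopic.Quotient z z :=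
  (Path.Homotopic.Quotient.mk γ).symm.trans
    ((g.map (K.exteriorHomeo f hN : C(K.exterior, K.exterior))).trans (.mk γ))

lemma map_act (x : FundQuandle K z) (g : Path.Homotopic.Quotient z z) :
    map hN γ (act x g) = act (map hN γ x) (loopMap hN γ g) := by
  induction x using ind with | h a =>
  induction g with | mk g =>
  have hpath : (((Path.Homotopic.Quotient.mk a.path).trans (.mk g)).map
        (K.exteriorHomeo f hN : C(K.exterior, K.exterior))).trans (.mk γ) =
      (((Path.Homotopic.Quotient.mk a.path).map
        (K.exteriorHomeo f hN : C(K.exterior, K.exterior))).trans (.mk γ)).trans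
        (loopMap hN γ (.mk g)) := by
    simp only [loopMap, pathClass_map_trans, Path.Homotopic.Quotient.trans_assoc,
      pathClass_trans_symm_cancel_left]
  exact mk_eq_of_path (p := K.boundaryHomeo f hN a.start) hpath

lemma loopMap_bd_mk (b : K.Arc z) : loopMap hN γ (bd (mk b)) =
    (Path.Homotopic.Quotient.mk (b.image f hN γ).path).symm.trans
      ((((Path.Homotopic.Quotient.mk (K.meridian b.start)).map
        (K.boundaryHomeo f hN : C(K.boundary, K.boundary))).map K.incl).trans
          (.mk (b.image f hN γ).path)) :=
  pathClass_conj_map (K.exteriorHomeo f hN : C(K.exterior, K.exterior)) (.mk b.path)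
    ((Path.Homotopic.Quotient.mk (K.meridian b.start)).map K.incl) (.mk γ)

lemma bd_map_mk (b : K.Arc z) : bd (map hN γ (mk b)) =
    (Path.Homotopic.Quotient.mk (b.image f hN γ).path).symm.trans
      (((Path.Homotopic.Quotient.mk (K.meridian (K.boundaryHomeo f hN b.start))).map K.incl).trans
        (.mk (b.image f hN γ).path)) := rfl

lemma loopMap_bd_of_preservesNormalOrientation (h : K.PreservesNormalOrientation f)
    (x : FundQuandle K z) : loopMap hN γ (bd x) = bd (map hN γ x) := by
  induction x using ind with | h b =>
  rw [loopMap_bd_mk, map_mk_meridian_of_preservesNormalOrientation hN h, bd_map_mk]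

lemma loopMap_bd_of_reversesNormalOrientation (h : K.ReversesNormalOrientation f)
    (x : FundQuandle K z) : loopMap hN γ (bd x) = (bd (map hN γ x)).symm := by
  induction x using ind with | h b =>
  rw [loopMap_bd_mk, map_mk_meridian_of_reversesNormalOrientation hN h, bd_map_mk,
    pathClass_map_symm]
  exact (pathClass_conj_symm _ _).symm

lemma isAut_map (h : K.PreservesNormalOrientation f) : IsAut (map hN γ) :=
  ⟨map_bijective hN γ, fun x y =>
    (map_act hN γ x (bd y)).trans <|
      congrArg (act _) (loopMap_bd_of_preservesNormalOrientation hN γ h y)⟩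

lemma isAntiAut_map (h : K.ReversesNormalOrientation f) : IsAntiAut (map hN γ) :=
  ⟨map_bijective hN γ, fun x y =>
    (map_act hN γ x (bd y)).trans <|
      congrArg (act _) (loopMap_bd_of_reversesNormalOrientation hN γ h y)⟩

lemma map_mk_eq_mk_image₀ (hz : K.exteriorHomeo f hN z = z) (a : K.Arc z) :
    map hN ((Path.refl z).cast hz rfl) (mk a) = mk (a.image₀ f hN hz) := by
  refine mk_eq_of_path (p := K.boundaryHomeo f hN a.start) ?_
  have hcast : (a.path.map (K.exteriorHomeo f hN).continuous).trans ((Path.refl z).cast hz rfl) =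
      ((a.path.map (K.exteriorHomeo f hN).continuous).cast rfl hz.symm).trans (Path.refl z) := by
    ext t
    simp [Path.trans_apply]
  rw [hcast]
  exact Path.Homotopic.Quotient.trans_refl (.mk _)

end FundQuandle

end Knot

open Knot.FundQuandle in
theorem proposition1_general (K : Knot) (z : K.exterior) (f : S3 ≃ₜ S3)
    (hN : f '' K.nbhd = K.nbhd) :
    (K.boundaryClass f hN = 1 ∨ K.boundaryClass f hN = MCG.negOne →
      K.PreservesNormalOrientation f ∨ K.ReversesNormalOrientation f) ∧
    (∀ hz : K.exteriorHomeo f hN z = z,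
      ∃ F : K.FundQuandle z → K.FundQuandle z,
        (∀ a : K.Arc z, F (.mk a) = .mk (a.image₀ f hN hz)) ∧
        (K.PreservesNormalOrientation f → IsAut F) ∧
        (K.ReversesNormalOrientation f → IsAntiAut F)) ∧
    Nonempty (Path (K.exteriorHomeo f hN z) z) ∧
    (∀ γ : Path (K.exteriorHomeo f hN z) z,
      ∃ F : K.FundQuandle z → K.FundQuandle z,
        (∀ a : K.Arc z, F (.mk a) = .mk (a.image f hN γ)) ∧
        (K.PreservesNormalOrientation f → IsAut F) ∧
        (K.ReversesNormalOrientation f → IsAntiAut F)) :=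
  ⟨Or.imp (Knot.preservesNormalOrientation_of_boundaryClass_eq_one hN)
      (Knot.reversesNormalOrientation_of_boundaryClass_eq_negOne hN),
    fun hz => ⟨map hN _, map_mk_eq_mk_image₀ hN hz, isAut_map hN _, isAntiAut_map hN _⟩,
    Knot.exterior_joined _ _,
    fun γ => ⟨map hN γ, map_mk hN γ, isAut_map hN γ, isAntiAut_map hN γ⟩⟩

theorem proposition1 (K : Knot) (z : K.exterior) (f : S3 ≃ₜ S3)
    (hK : f '' K.carrier = K.carrier) (hN : f '' K.nbhd = K.nbhd)
    (hf : K.boundaryClass f hN = 1 ∨ K.boundaryClass f hN = MCG.negOne) :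
    (K.PreservesNormalOrientation f ∨ K.ReversesNormalOrientation f) ∧
    (∀ hz : K.exteriorHomeo f hN z = z,
      ∃ F : K.FundQuandle z → K.FundQuandle z,
        (∀ a : K.Arc z, F (.mk a) = .mk (a.image₀ f hN hz)) ∧
        (K.PreservesNormalOrientation f → Knot.FundQuandle.IsAut F) ∧
        (K.ReversesNormalOrientation f → Knot.FundQuandle.IsAntiAut F)) ∧
    Nonempty (Path (K.exteriorHomeo f hN z) z) ∧
    (∀ γ : Path (K.exteriorHomeo f hN z) z,
      ∃ F : K.FundQuandle z → K.FundQuandle z,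
        (∀ a : K.Arc z, F (.mk a) = .mk (a.image f hN γ)) ∧
        (K.PreservesNormalOrientation f → Knot.FundQuandle.IsAut F) ∧
        (K.ReversesNormalOrientation f → Knot.FundQuandle.IsAntiAut F)) :=
  let ⟨h₁, h₂⟩ := proposition1_general K z f hN
  ⟨h₁ hf, h₂⟩
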